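/- Let $\Bbbk$ be a field, $n\in\mathbb N$, $[n]=\{0,\dots,n-1\}$, $[2]=\{0,1\}$, and let $C$ be a set of functions $[n]\to[2]$. Let $S=\Bbbk[x_{i,j}: i\in[n],\ j\in[2]]$ with its $\mathbb N^{[n]\times[2]}$-grading, and let $\mathcal S_C$ be the abstract simplicial complex on the vertex set $[n]\times[2]$ whose faces are the subsets of graphs of functions $f\in C$ (there are no faces if $C=\emptyset$). Let $$I_C=\langle \mathbf x^{\tau} : \tau\subseteq[n]\times[2],\ \tau\notin\mathcal S_C\rangle\subseteq S,\qquad \mathbf x^\tau=\prod_{(i,j)\in\tau}x_{i,j},$$ be its Stanley–Reisner ideal. For $i\ge 0$ and $\mathbf a\in\mathbb N^{[n]\times[2]}$ let the Betti number $\beta_{i,\mathbf a}(I_C)$ be the multiplicity of $S(-\mathbf a)$ as a summand of the module $F_i$ in a minimal $\mathbb N^{[n]\times[2]}$-graded free resolution $0\leftarrow I_C\leftarrow F_0\leftarrow F_1\leftarrow\cdots$. For $U\subseteq[n]$, say that $C$ shatters $U$ if every function $U\to[2]$ is the restriction to $U$ of some $f\in C$. **Theorem.** For every nonempty $U\subseteq[n]$,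 $C$ shatters $U$ if and only if $$\beta_{|U|-1,\ U\times[2]}(I_C)\neq 0,$$ where $U\times[2]$ is identified with its $0/1$ indicator vector in $\mathbb N^{[n]\times[2]}$. -/

import Mathlib

/-! ### Classes of functions -/

/-- The restriction `C ↾ U ⊆ [U → m]` of a class `C ⊆ [n → m]` to a set `U` of inputs. -/
def restrictClass {n m : ℕ} (C : Set (Fin n → Fin m)) (U : Finset (Fin n)) :
    Set (U → Fin m) :=
  (fun (f : Fin n → Fin m) (u : U) => f u) '' C

/-- `C` shatters `U` if `C ↾ U = [U → 2]`. -/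
def ClassShatters {n : ℕ} (C : Set (Fin n → Fin 2)) (U : Finset (Fin n)) : Prop :=
  restrictClass C U = Set.univ

/-- The canonical suboplex of a class `C ⊆ [n → m]`, as an abstract simplicial complex (a downward
closed family of finite sets, the empty face included) on the set `[n] × [m]` of potential
vertices. Its facets are the graphs of the functions in `C`; its faces are the graphs of the
partial functions that have an extension in `C`. For `C = ∅` there are no faces at all. -/
def canonicalSuboplex {n m : ℕ} (C : Set (Fin n → Fin m)) :
    LowerSet (Finset (Fin n × Fin m)) where
  carrier := {s | ∃ f ∈ C, ∀ p ∈ s, f p.1 = p.2}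
  lower' := by
    rintro s t hts ⟨f, hf, hs⟩
    exact ⟨f, hf, fun p hp => hs p (hts hp)⟩

/-! ### Stanley–Reisner ideals -/

/-- The squarefree exponent vector in `ℕ^σ` of a finite set `s` of variables. -/
noncomputable def squarefreeDegree {σ : Type*} (s : Finset σ) : σ →₀ ℕ :=
  ∑ i ∈ s, Finsupp.single i 1

/-- The Stanley–Reisner ideal `⟨x^τ : τ ∉ Δ⟩` of a simplicial complex `Δ`. -/
noncomputable def stanleyReisnerIdeal (k : Type*) [Field k] {σ : Type*}
    (Δ : LowerSet (Finset σ)) : Ideal (MvPolynomial σ k) :=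
  Ideal.span {p | ∃ τ : Finset σ, τ ∉ Δ ∧ p = MvPolynomial.monomial (squarefreeDegree τ) 1}

/-- The Stanley–Reisner ideal `I_C` of a class `C ⊆ [n → m]`, in the polynomial ring over `k` with
variables `x_{i,j}`, `(i, j) ∈ [n] × [m]`. -/
noncomputable def classIdeal (k : Type*) [Field k] {n m : ℕ} (C : Set (Fin n → Fin m)) :
    Ideal (MvPolynomial (Fin n × Fin m) k) :=
  stanleyReisnerIdeal k (canonicalSuboplex C)

/-! ### Minimal multigraded free resolutions and Betti numbers -/

/-- A minimal `ℕ^σ`-graded free resolution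
`0 ← I ← F_0 ← F_1 ← F_2 ← ⋯` of an ideal `I` of `S = k[x_i : i ∈ σ]`.
The module `F_i = ⨁_j S(-deg i j)` is free of finite rank, with a homogeneous basis
`e_j`, `j < rank i`, in multidegrees `deg i j`; maps are degree-preserving. The augmentation
`F_0 → I` is recorded as a map `ε : F_0 → S` with image `I`. -/
structure MinimalFreeResolution {k : Type*} [Field k] {σ : Type*}
    (I : Ideal (MvPolynomial σ k)) where
  /-- the rank of `F_i` -/
  rank : ℕ → ℕ
  /-- the multidegree of the `j`-th basis element of `F_i` -/
  deg : (i : ℕ) → Fin (rank i) → (σ →₀ ℕ)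
  /-- the augmentation -/
  ε : (Fin (rank 0) → MvPolynomial σ k) →ₗ[MvPolynomial σ k] MvPolynomial σ k
  /-- the differential `F_{i+1} → F_i` -/
  d : (i : ℕ) → (Fin (rank (i + 1)) → MvPolynomial σ k) →ₗ[MvPolynomial σ k]
    (Fin (rank i) → MvPolynomial σ k)
  /-- `ε` preserves multidegrees: `ε e_j` is homogeneous of multidegree `deg 0 j`. -/
  ε_graded : ∀ (j : Fin (rank 0)) (a : σ →₀ ℕ),
    MvPolynomial.coeff a (ε (Pi.single j 1)) ≠ 0 → a = deg 0 j
  /-- `d i` preserves multidegrees: the coordinate of `d e_j` along `e_l` is homogeneous of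
  multidegree `deg (i + 1) j - deg i l` (and zero if this is not in `ℕ^σ`). -/
  d_graded : ∀ (i : ℕ) (j : Fin (rank (i + 1))) (l : Fin (rank i)) (a : σ →₀ ℕ),
    MvPolynomial.coeff a (d i (Pi.single j 1) l) ≠ 0 → a + deg i l = deg (i + 1) j
  /-- the image of the augmentation is `I` -/
  range_ε : LinearMap.range ε = I
  /-- exactness at `F_0` -/
  exact_zero : LinearMap.range (d 0) = LinearMap.ker ε
  /-- exactness at `F_{i+1}` -/
  exact_succ : ∀ i : ℕ, LinearMap.range (d (i + 1)) = LinearMap.ker (d i)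
  /-- minimality: all matrix entries of the differentials lie in the ideal `⟨x_i : i ∈ σ⟩` -/
  minimal : ∀ (i : ℕ) (j : Fin (rank (i + 1))) (l : Fin (rank i)),
    MvPolynomial.constantCoeff (d i (Pi.single j 1) l) = 0

/-- The number of summands `S(-a)` in the `i`-th module of a minimal free resolution. -/
noncomputable def MinimalFreeResolution.multiplicity {k : Type*} [Field k] {σ : Type*}
    {I : Ideal (MvPolynomial σ k)} (F : MinimalFreeResolution I) (i : ℕ) (a : σ →₀ ℕ) : ℕ :=
  Nat.card {j : Fin (F.rank i) // F.deg i j = a}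

open Classical in
/-- The `i`-th Betti number `β_{i,a}(I)` of `I` in multidegree `a`: the multiplicity of `S(-a)` in
the `i`-th module of a minimal multigraded free resolution of `I`. (For a monomial ideal in
finitely many variables such a resolution exists, and the multiplicity is the same for all of
them.) -/
noncomputable def bettiNumber {k : Type*} [Field k] {σ : Type*}
    (I : Ideal (MvPolynomial σ k)) (i : ℕ) (a : σ →₀ ℕ) : ℕ :=
  if h : Nonempty (MinimalFreeResolution I) then h.some.multiplicity i a else 0

/-! The summands of `F_p` in degree `a` count the dimension of `Tor_p(I_C, k)` in degree `a`, and
Tor can also be read off the Koszul complex of `I_C`. In the degree of `U × [2]` a Koszul chain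
assigns to each `B ⊆ U × [2]`, the complement of the exterior part, an element of `(I_C)_B`. With
all variables set to `1`, multiplication by a variable becomes an inclusion, so only a family of
subspaces indexed by `B` remains: `(I_C)_B` is `0` when `B` is a face and `k` otherwise.

The same complex for `S` is exact, so the homology in degree `|U| - 1` is the reduced cohomology, in
degree `|U| - 1`, of the part of `𝒮_C` over `U` (Hochster's formula). That part is a subcomplex of
the boundary of a cross-polytope, a sphere of dimension `|U| - 1`, and its possible facets are the
graphs of functions `U → [2]`. If all are present, the fundamental cycle detects a nonzero class. If
one is missing, every facet cochain can be pushed across ridges to the missing facet and so is a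
coboundary. This is `koszulExactAt_suboplex_iff`.

Only vanishing is needed for the comparison with Betti numbers, so dimension shifting suffices. For
a minimal cover of `M` with kernel `N`, exactness at `p + 1` for `M` is exactness at `p` for `N`
(`koszulExactAt_succ_iff`), and exactness at `0` says that no generator has the full degree
(`koszulExactAt_zero_iff`). Iteration along the resolution gives `koszulExactAt_augmentation_iff`.
Because `bettiNumber` is `0` by default, existence of a resolution is also proved
(`nonempty_minimalFreeResolution`). -/

set_option linter.unusedSectionVars false

/-! ### Koszul complexes in one squarefree degree, and dimension shifting -/

section Koszul

variable {k : Type*} [Field k] {α : Type*} [Fintype α] [DecidableEq α]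
  {W : Type*} [AddCommGroup W] [Module k W]

/-- The sign with which `i` is removed from the finite set `B`, for the order given by `ρ`. -/
def koszulSign (k : Type*) [Field k] {α : Type*} (ρ : α → ℕ) (B : Finset α) (i : α) : k :=
  ∏ l ∈ B, if ρ l < ρ i then -1 else 1

/-- The Koszul differential in a fixed squarefree degree. A chain is indexed by the complement of
its exterior part. -/
def koszulBoundary (k : Type*) [Field k] {α : Type*} [DecidableEq α] (W : Type*) [AddCommGroup W]
    [Module k W] (ρ : α → ℕ) : (Finset α → W) →ₗ[k] (Finset α → W) where
  toFun c B := ∑ i ∈ B, koszulSign k ρ B i • c (B.erase i)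
  map_add' c c' := by
    funext B
    simp [smul_add, Finset.sum_add_distrib]
  map_smul' r c := by
    funext B
    simp [Finset.smul_sum, smul_comm r]

lemma koszulBoundary_apply (ρ : α → ℕ) (c : Finset α → W) (B : Finset α) :
    koszulBoundary k W ρ c B = ∑ i ∈ B, koszulSign k ρ B i • c (B.erase i) := rfl

lemma koszulSign_mul_self (ρ : α → ℕ) (B : Finset α) (i : α) :
    koszulSign k ρ B i * koszulSign k ρ B i = 1 := by
  rw [koszulSign, ← Finset.prod_mul_distrib]
  refine Finset.prod_eq_one fun l _ => ?_
  split_ifs <;> simp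

lemma koszulSign_ne_zero (ρ : α → ℕ) (B : Finset α) (i : α) : koszulSign k ρ B i ≠ 0 :=
  left_ne_zero_of_mul_eq_one (koszulSign_mul_self ρ B i)

lemma koszulSign_erase (ρ : α → ℕ) {B : Finset α} {x : α} (hx : x ∈ B) (i : α) :
    koszulSign k ρ B i = (if ρ x < ρ i then -1 else 1) * koszulSign k ρ (B.erase x) i := by
  rw [koszulSign, koszulSign, Finset.mul_prod_erase B (fun l => if ρ l < ρ i then (-1 : k) else 1) hx]

/-- Removing two elements in either order differs by one sign: exactly one of `ρ i < ρ l` and `ρ l <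
ρ i` holds. This gives `∂² = 0`. -/
lemma koszulSign_swap {ρ : α → ℕ} (hρ : Function.Injective ρ) {B : Finset α} {i l : α}
    (hi : i ∈ B) (hl : l ∈ B) (hil : i ≠ l) :
    koszulSign k ρ B i * koszulSign k ρ (B.erase i) l
      = -(koszulSign k ρ B l * koszulSign k ρ (B.erase l) i) := by
  rw [koszulSign_erase ρ hl i, koszulSign_erase ρ hi l]
  have h : ρ i ≠ ρ l := fun h => hil (hρ h)
  rcases lt_or_gt_of_ne h with h | h
  · rw [if_neg h.not_gt, if_pos h]; ring
  · rw [if_neg h.not_gt, if_pos h]; ring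

lemma koszulBoundary_koszulBoundary {ρ : α → ℕ} (hρ : Function.Injective ρ) (c : Finset α → W) :
    koszulBoundary k W ρ (koszulBoundary k W ρ c) = 0 := by
  funext B
  simp only [koszulBoundary_apply, Finset.smul_sum, smul_smul, Pi.zero_apply]
  rw [Finset.sum_sigma']
  refine Finset.sum_involution (fun p _ => ⟨p.2, p.1⟩) ?_ ?_ ?_ ?_
  · rintro ⟨i, l⟩ h
    simp only [Finset.mem_sigma, Finset.mem_erase] at h
    dsimp only
    rw [koszulSign_swap hρ h.1 h.2.2 h.2.1.symm, Finset.erase_right_comm, neg_smul]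
    exact neg_add_cancel _
  · rintro ⟨i, l⟩ h - heq
    simp only [Finset.mem_sigma, Finset.mem_erase] at h
    simp only [Sigma.mk.injEq, heq_eq_eq] at heq
    exact h.2.1 heq.1
  · rintro ⟨i, l⟩ h
    simp only [Finset.mem_sigma, Finset.mem_erase] at h ⊢
    exact ⟨h.2.2, h.2.1.symm, h.1⟩
  · rintro ⟨i, l⟩ h
    rfl

lemma koszulBoundary_map {W' : Type*} [AddCommGroup W'] [Module k W'] (ρ : α → ℕ) (f : W →ₗ[k] W')
    (c : Finset α → W) (B : Finset α) :
    koszulBoundary k W' ρ (fun B => f (c B)) B = f (koszulBoundary k W ρ c B) := by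
  simp [koszulBoundary_apply]

/-- Koszul chains of homological degree `p` with coefficients in a filtered vector space. -/
structure IsKoszulChain (M : Finset α → Submodule k W) (p : ℕ) (c : Finset α → W) : Prop where
  mem : ∀ B, c B ∈ M B
  card : ∀ B, c B ≠ 0 → B.card + p = Fintype.card α

/-- Exactness of the Koszul complex in homological degree `p`. -/
def KoszulExactAt (ρ : α → ℕ) (M : Finset α → Submodule k W) (p : ℕ) : Prop :=
  ∀ c, IsKoszulChain M p c → koszulBoundary k W ρ c = 0 →
    ∃ c', IsKoszulChain M (p + 1) c' ∧ koszulBoundary k W ρ c' = c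

lemma IsKoszulChain.sub {M : Finset α → Submodule k W} {p : ℕ} {c c' : Finset α → W}
    (h : IsKoszulChain M p c) (h' : IsKoszulChain M p c') : IsKoszulChain M p (c - c') where
  mem B := (M B).sub_mem (h.mem B) (h'.mem B)
  card B hB := by
    by_cases hc : c B = 0
    · exact h'.card B fun hc' => hB (by simp [hc, hc'])
    · exact h.card B hc

lemma IsKoszulChain.boundary {M : Finset α → Submodule k W} (hM : Monotone M) {ρ : α → ℕ} {p : ℕ}
    {c : Finset α → W} (h : IsKoszulChain M (p + 1) c) :
    IsKoszulChain M p (koszulBoundary k W ρ c) where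
  mem B := Submodule.sum_mem _ fun i _ =>
    Submodule.smul_mem _ _ (hM (Finset.erase_subset i B) (h.mem _))
  card B hB := by
    obtain ⟨i, hi, hne⟩ := Finset.exists_ne_zero_of_sum_ne_zero hB
    have := h.card _ (right_ne_zero_of_smul hne)
    have := Finset.card_erase_add_one hi
    omega

lemma IsKoszulChain.boundary_eq_zero {M : Finset α → Submodule k W} {ρ : α → ℕ}
    {c : Finset α → W} (h : IsKoszulChain M 0 c) : koszulBoundary k W ρ c = 0 := by
  funext B
  refine Finset.sum_eq_zero fun i _ => ?_
  by_contra hne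
  have := h.card _ (right_ne_zero_of_smul hne)
  rw [add_zero, Finset.card_eq_iff_eq_univ] at this
  exact Finset.notMem_erase i B (this ▸ Finset.mem_univ i)

lemma IsKoszulChain.map {W' : Type*} [AddCommGroup W'] [Module k W'] (f : W →ₗ[k] W')
    {M : Finset α → Submodule k W} {M' : Finset α → Submodule k W'}
    (hf : ∀ B, ∀ v ∈ M B, f v ∈ M' B) {p : ℕ} {c : Finset α → W}
    (h : IsKoszulChain M p c) : IsKoszulChain M' p (fun B => f (c B)) where
  mem B := hf B _ (h.mem B)
  card B hB := h.card B fun h0 => hB (by simp [h0])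

/-- The coordinate subspaces of the free vector space on `J` cut out by a predicate. -/
def coordinateFiltration (k : Type*) [Field k] {β J : Type*} (P : J → β → Prop) (B : β) :
    Submodule k (J → k) where
  carrier := {v | ∀ j, v j ≠ 0 → P j B}
  add_mem' {v w} hv hw j h := by
    by_cases hj : v j = 0
    · exact hw j fun hj' => h (by simp [hj, hj'])
    · exact hv j hj
  zero_mem' j h := absurd rfl h
  smul_mem' r v hv j h := hv j fun h0 => h (by simp [h0])

variable {J : Type*} {P : J → Finset α → Prop}

lemma coordinateFiltration_mono (hP : ∀ j, Monotone (P j)) :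
    Monotone (coordinateFiltration k P) :=
  fun _ _ hB _ hv j hj => hP j hB (hv j hj)

/-- A free module has no Koszul homology away from the generators in top degree. -/
lemma exists_koszulBoundary_eq {ρ : α → ℕ} (hρ : Function.Injective ρ) {p : ℕ}
    {c : Finset α → J → k} (hc : IsKoszulChain (coordinateFiltration k P) p c)
    (h0 : koszulBoundary k (J → k) ρ c = 0)
    (hJ : ∀ j, (∃ x, ∀ B, P j B → P j (B.erase x)) ∨ ∀ B, c B j = 0) :
    ∃ c', IsKoszulChain (coordinateFiltration k P) (p + 1) c' ∧
      koszulBoundary k (J → k) ρ c' = c := by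
  classical
  have hJ' : ∀ j, ∃ x : Option α, (∀ y, x = some y → ∀ B, P j B → P j (B.erase y)) ∧
      (x = none → ∀ B, c B j = 0) := fun j => by
    rcases hJ j with ⟨x, hx⟩ | h
    · exact ⟨some x, by simpa using hx, by simp⟩
    · exact ⟨none, by simp, fun _ => h⟩
  choose x hx hn using hJ'
  -- A cone contraction, coordinate by coordinate: the vertex `y` can be erased without leaving the
  -- support condition `P j`, so it serves as apex.
  let c' : Finset α → J → k := fun B j => match x j with
    | none => 0
    | some y => if y ∈ B then 0 else koszulSign k ρ (insert y B) y * c (insert y B) j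
  have hc' : ∀ B j, c' B j ≠ 0 → ∃ y, x j = some y ∧ y ∉ B ∧ c (insert y B) j ≠ 0 := by
    intro B j h
    simp only [c'] at h
    split at h
    · exact absurd rfl h
    · rename_i y hy
      split_ifs at h with hyB
      · exact absurd rfl h
      · exact ⟨y, hy, hyB, right_ne_zero_of_mul h⟩
  refine ⟨c', ⟨?_, ?_⟩, ?_⟩
  · intro B j h
    obtain ⟨y, hy, hyB, hne⟩ := hc' B j h
    have := hx j y hy _ (hc.mem _ j hne)
    rwa [Finset.erase_insert hyB] at this
  · intro B h
    obtain ⟨j, hj⟩ := Function.ne_iff.1 h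
    obtain ⟨y, hy, hyB, hne⟩ := hc' B j hj
    have := hc.card (insert y B) (fun h => hne (by simp [h]))
    rw [Finset.card_insert_of_notMem hyB] at this
    omega
  · funext B j
    rw [koszulBoundary_apply, Finset.sum_apply]
    simp only [Pi.smul_apply, smul_eq_mul]
    rcases hxj : x j with _ | y
    · simp [c', hxj, hn j hxj]
    · have e : ∀ B, c' B j =
          if y ∈ B then 0 else koszulSign k ρ (insert y B) y * c (insert y B) j := by
        intro B; simp only [c', hxj]
      simp only [e]
      by_cases hy : y ∈ B
      · rw [Finset.sum_eq_single_of_mem y hy]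
        · rw [if_neg (Finset.notMem_erase y B), Finset.insert_erase hy, ← mul_assoc,
            koszulSign_mul_self, one_mul]
        · intro i _ hi
          rw [if_pos (Finset.mem_erase.2 ⟨hi.symm, hy⟩), mul_zero]
      · have h1 := congrFun (congrFun h0 (insert y B)) j
        rw [koszulBoundary_apply, Finset.sum_insert hy, Finset.erase_insert hy] at h1
        simp only [Pi.add_apply, Finset.sum_apply, Pi.smul_apply, smul_eq_mul,
          Pi.zero_apply] at h1
        have h2 : ∀ i ∈ B, koszulSign k ρ B i * (if y ∈ B.erase i then 0 else
            koszulSign k ρ (insert y (B.erase i)) y * c (insert y (B.erase i)) j)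
            = -koszulSign k ρ (insert y B) y *
              (koszulSign k ρ (insert y B) i * c ((insert y B).erase i) j) := by
          intro i hi
          have hyi : y ≠ i := fun h => hy (h ▸ hi)
          rw [if_neg fun h => hy (Finset.mem_of_mem_erase h), ← Finset.erase_insert_of_ne hyi]
          have := koszulSign_swap (k := k) hρ (Finset.mem_insert_self y B)
            (Finset.mem_insert_of_mem hi) hyi
          rw [Finset.erase_insert hy] at this
          have s1 := koszulSign_mul_self (k := k) ρ (insert y B) y
          have s2 := koszulSign_mul_self (k := k) ρ ((insert y B).erase i) y
          -- The swap identity, with signs moved across using that each squares to `1`.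
          linear_combination c ((insert y B).erase i) j *
            (koszulSign k ρ (insert y B) y * koszulSign k ρ ((insert y B).erase i) y * this
              - koszulSign k ρ B i * koszulSign k ρ ((insert y B).erase i) y * s1
              - koszulSign k ρ (insert y B) y * koszulSign k ρ (insert y B) i * s2)
        rw [Finset.sum_congr rfl h2, ← Finset.mul_sum]
        have s1 := koszulSign_mul_self (k := k) ρ (insert y B) y
        linear_combination c B j * s1 - koszulSign k ρ (insert y B) y * h1

/-- Zero values are lifted to zero, so that the lift keeps the homological degree. -/
lemma IsKoszulChain.exists_lift {M : Finset α → Submodule k W} (π : (J → k) →ₗ[k] W)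
    (hM : ∀ B, M B = (coordinateFiltration k P B).map π) {p : ℕ} {c : Finset α → W}
    (h : IsKoszulChain M p c) :
    ∃ c', IsKoszulChain (coordinateFiltration k P) p c' ∧ (fun B => π (c' B)) = c := by
  have : ∀ B, ∃ v ∈ coordinateFiltration k P B, π v = c B ∧ (c B = 0 → v = 0) := by
    intro B
    by_cases h0 : c B = 0
    · exact ⟨0, Submodule.zero_mem _, by simp [h0], fun _ => rfl⟩
    · have := h.mem B
      rw [hM] at this
      obtain ⟨v, hv, hv'⟩ := this
      exact ⟨v, hv, hv', fun h => absurd h h0⟩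
  choose c' h1 h2 h3 using this
  exact ⟨c', ⟨h1, fun B hB => h.card B fun h0 => hB (h3 B h0)⟩, funext h2⟩

/-- Dimension shifting along a minimal free cover `π` of `M` with kernel `N`. -/
lemma koszulExactAt_succ_iff {ρ : α → ℕ} (hρ : Function.Injective ρ) (hP : ∀ j, Monotone (P j))
    (hJ : ∀ j, (∃ x, ∀ B, P j B → P j (B.erase x)) ∨ ∀ B, P j B → B = Finset.univ)
    {M : Finset α → Submodule k W} {N : Finset α → Submodule k (J → k)} (π : (J → k) →ₗ[k] W)
    (hM : ∀ B, M B = (coordinateFiltration k P B).map π)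
    (hN : ∀ B, N B = coordinateFiltration k P B ⊓ LinearMap.ker π)
    (hmin : ∀ v ∈ N Finset.univ, ∀ j, (∀ B, P j B → B = Finset.univ) → v j = 0) (p : ℕ) :
    KoszulExactAt ρ M (p + 1) ↔ KoszulExactAt ρ N p := by
  have hNV : ∀ B, ∀ v ∈ N B, v ∈ coordinateFiltration k P B := fun B v hv => by
    rw [hN] at hv; exact hv.1
  have hNk : ∀ B, ∀ v ∈ N B, π v = 0 := fun B v hv => by
    rw [hN] at hv; exact hv.2
  have hVM : ∀ B, ∀ v ∈ coordinateFiltration k P B, π v ∈ M B := fun B v hv => by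
    rw [hM]; exact ⟨v, hv, rfl⟩
  have hV := coordinateFiltration_mono (k := k) hP
  have acyclic : ∀ c : Finset α → J → k, IsKoszulChain (coordinateFiltration k P) (p + 1) c →
      koszulBoundary k (J → k) ρ c = 0 → ∃ c', IsKoszulChain (coordinateFiltration k P) (p + 2) c' ∧
      koszulBoundary k (J → k) ρ c' = c := by
    intro c hc h0
    -- In positive homological degree a chain vanishes at the full set, so generators occurring only
    -- there do not contribute.
    refine exists_koszulBoundary_eq hρ hc h0 fun j => (hJ j).imp_right fun h B => ?_
    by_contra hne
    have h1 := hc.card B fun h => hne (by simp [h])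
    rw [h B (hc.mem B j hne), Finset.card_univ] at h1
    omega
  constructor
  · intro hex c hc h0
    have hcV : IsKoszulChain (coordinateFiltration k P) p c := ⟨fun B => hNV B _ (hc.mem B), hc.card⟩
    -- Here `p` may be `0`; minimality, not the degree, now kills the coordinates of full-degree
    -- generators.
    obtain ⟨v, hv, rfl⟩ := exists_koszulBoundary_eq hρ hcV h0 fun j => (hJ j).imp_right fun h B => by
      by_contra hne
      have hB := h B (hcV.mem B j hne)
      subst hB
      exact hne (hmin _ (hc.mem _) j h)
    obtain ⟨m, hm, hm'⟩ := hex _ (hv.map π hVM) (by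
      funext B
      rw [koszulBoundary_map]
      exact hNk B _ (hc.mem B))
    obtain ⟨w, hw, rfl⟩ := hm.exists_lift π hM
    -- The correction by `∂w` moves `v` into the kernel of `π` without changing its boundary.
    refine ⟨v - koszulBoundary k (J → k) ρ w, ?_, ?_⟩
    · have h := hv.sub (hw.boundary (ρ := ρ) hV)
      refine ⟨fun B => ?_, h.card⟩
      rw [hN]
      refine ⟨h.mem B, ?_⟩
      have := congrFun hm' B
      rw [koszulBoundary_map] at this
      simp [this]
    · rw [map_sub, koszulBoundary_koszulBoundary hρ, sub_zero]
  · intro hex m hm h0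
    obtain ⟨v, hv, rfl⟩ := hm.exists_lift π hM
    have hb := hv.boundary (ρ := ρ) hV
    obtain ⟨n, hn, hn'⟩ := hex (koszulBoundary k (J → k) ρ v) ⟨fun B => by
        rw [hN]
        refine ⟨hb.mem B, ?_⟩
        have := congrFun h0 B
        rwa [koszulBoundary_map] at this, hb.card⟩ (koszulBoundary_koszulBoundary hρ v)
    have hnV : IsKoszulChain (coordinateFiltration k P) (p + 1) n :=
      ⟨fun B => hNV B _ (hn.mem B), hn.card⟩
    obtain ⟨w, hw, hw'⟩ := acyclic (v - n) (hv.sub hnV) (by rw [map_sub, hn', sub_self])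
    refine ⟨_, hw.map π hVM, ?_⟩
    funext B
    rw [koszulBoundary_map, hw']
    simp [hNk B _ (hn.mem B)]

lemma koszulExactAt_zero_iff {ρ : α → ℕ} (hρ : Function.Injective ρ) (hP : ∀ j, Monotone (P j))
    (hJ : ∀ j, (∃ x, ∀ B, P j B → P j (B.erase x)) ∨ ∀ B, P j B → B = Finset.univ)
    {M : Finset α → Submodule k W} {N : Finset α → Submodule k (J → k)} (π : (J → k) →ₗ[k] W)
    (hM : ∀ B, M B = (coordinateFiltration k P B).map π)
    (hN : ∀ B, N B = coordinateFiltration k P B ⊓ LinearMap.ker π)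
    (hmin : ∀ v ∈ N Finset.univ, ∀ j, (∀ B, P j B → B = Finset.univ) → v j = 0) :
    KoszulExactAt ρ M 0 ↔ ∀ j, P j Finset.univ → ∃ B, P j B ∧ B ≠ Finset.univ := by
  classical
  have hVM : ∀ B, ∀ v ∈ coordinateFiltration k P B, π v ∈ M B := fun B v hv => by
    rw [hM]; exact ⟨v, hv, rfl⟩
  have hV := coordinateFiltration_mono (k := k) hP
  constructor
  · intro hex j hj
    by_contra! hne
    -- A generator of exactly the full degree gives a degree-zero cycle. If its image bounded,
    -- minimality would force its `j`-th coordinate, which is `1`, to vanish.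
    let e : Finset α → J → k := fun B => if B = Finset.univ then Pi.single j 1 else 0
    have he : IsKoszulChain (coordinateFiltration k P) 0 e := by
      refine ⟨fun B => ?_, fun B hB => ?_⟩
      · by_cases hB : B = Finset.univ
        · subst hB
          intro l hl
          by_cases hlj : l = j
          · exact hlj ▸ hj
          · simp [e, hlj] at hl
        · simp [e, hB]
      · by_cases h : B = Finset.univ
        · simp [h]
        · simp [e, h] at hB
    obtain ⟨m, hm, hm'⟩ := hex _ (he.map π hVM) (by
      funext B
      rw [koszulBoundary_map, he.boundary_eq_zero, Pi.zero_apply, Pi.zero_apply, map_zero])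
    obtain ⟨w, hw, rfl⟩ := hm.exists_lift π hM
    have h1 : koszulBoundary k (J → k) ρ w Finset.univ j = 0 := by
      rw [koszulBoundary_apply, Finset.sum_apply]
      refine Finset.sum_eq_zero fun i _ => ?_
      rw [Pi.smul_apply, smul_eq_mul, mul_eq_zero]
      right
      by_contra h
      have h2 := hne _ (hw.mem _ j h)
      have := Finset.notMem_erase i Finset.univ
      rw [h2] at this
      exact this (Finset.mem_univ i)
    have h2 : (e - koszulBoundary k (J → k) ρ w) Finset.univ ∈ N Finset.univ := by
      rw [hN]
      refine ⟨(he.sub (hw.boundary hV)).mem _, ?_⟩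
      have := congrFun hm' Finset.univ
      rw [koszulBoundary_map] at this
      simp [this]
    have h3 := hmin _ h2 j hne
    rw [Pi.sub_apply, Pi.sub_apply, h1, sub_zero] at h3
    simp [e] at h3
  · intro h m hm _
    obtain ⟨v, hv, rfl⟩ := hm.exists_lift π hM
    obtain ⟨w, hw, rfl⟩ := exists_koszulBoundary_eq hρ hv hv.boundary_eq_zero fun j => by
      refine (hJ j).imp_right fun hj B => ?_
      by_contra hne
      have hB := hv.mem B j hne
      obtain ⟨B', hB', hne'⟩ := h j (hj B hB ▸ hB)
      exact hne' (hj B' hB')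
    exact ⟨_, hw.map π hVM, funext fun B => koszulBoundary_map ρ π w B⟩

end Koszul

/-! ### Top cohomology of subcomplexes of the cross-polytope -/

section Suboplex

variable {ι : Type*} [Fintype ι] [DecidableEq ι]

/-- The embedding of the domain of a function as its graph. -/
def graphEmbedding (f : ι → Fin 2) : ι ↪ ι × Fin 2 where
  toFun v := (v, f v)
  inj' u v h := congrArg Prod.fst (show (u, f u) = (v, f v) from h)

lemma graphEmbedding_apply (f : ι → Fin 2) (v : ι) : graphEmbedding f v = (v, f v) := rfl

/-- The graph of a function, as a facet of the cross-polytope. -/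
def graphFinset (f : ι → Fin 2) : Finset (ι × Fin 2) :=
  Finset.univ.map (graphEmbedding f)

lemma mem_graphFinset {f : ι → Fin 2} {p : ι × Fin 2} : p ∈ graphFinset f ↔ f p.1 = p.2 := by
  simp only [graphFinset, Finset.mem_map, Finset.mem_univ, graphEmbedding_apply, true_and]
  exact ⟨fun ⟨v, hv⟩ => by rw [← hv], fun h => ⟨p.1, by rw [h]⟩⟩

lemma card_graphFinset (f : ι → Fin 2) : (graphFinset f).card = Fintype.card ι := by
  rw [graphFinset, Finset.card_map, Finset.card_univ]

lemma eq_graphFinset {f : ι → Fin 2} {B : Finset (ι × Fin 2)} (h : ∀ p ∈ B, f p.1 = p.2)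
    (hB : B.card = Fintype.card ι) : B = graphFinset f :=
  Finset.eq_of_subset_of_card_le (fun p hp => mem_graphFinset.2 (h p hp))
    (by rw [hB, card_graphFinset])

lemma mem_graphFinset_erase {f : ι → Fin 2} {v : ι} {p : ι × Fin 2} :
    p ∈ (graphFinset f).erase (v, f v) ↔ p.1 ≠ v ∧ f p.1 = p.2 := by
  rw [Finset.mem_erase, mem_graphFinset]
  refine and_congr_left fun h => not_congr ⟨fun h => by rw [h], fun h' => ?_⟩
  rw [← h', h]

lemma graphFinset_erase_congr {f g : ι → Fin 2} {v : ι} (h : ∀ u, u ≠ v → f u = g u) :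
    (graphFinset f).erase (v, f v) = (graphFinset g).erase (v, g v) := by
  ext p
  rw [mem_graphFinset_erase, mem_graphFinset_erase]
  exact and_congr_right fun hp => by rw [h _ hp]

lemma graphFinset_erase_eq_iff {f g : ι → Fin 2} {u v : ι} :
    (graphFinset f).erase (u, f u) = (graphFinset g).erase (v, g v) ↔
      u = v ∧ ∀ w, w ≠ v → f w = g w := by
  constructor
  · intro h
    have huv : u = v := by
      by_contra hne
      have : (v, f v) ∈ (graphFinset f).erase (u, f u) :=
        mem_graphFinset_erase.2 ⟨fun h => hne h.symm, rfl⟩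
      rw [h] at this
      exact (mem_graphFinset_erase.1 this).1 rfl
    refine ⟨huv, fun w hw => ?_⟩
    have : (w, g w) ∈ (graphFinset g).erase (v, g v) := mem_graphFinset_erase.2 ⟨hw, rfl⟩
    rw [← h] at this
    exact (mem_graphFinset_erase.1 this).2
  · rintro ⟨rfl, h⟩
    exact graphFinset_erase_congr h

/-- The order on the vertices of the cross-polytope used for signs. -/
def vertexRank (r : ι → ℕ) (p : ι × Fin 2) : ℕ := 2 * r p.1 + p.2

lemma vertexRank_injective {r : ι → ℕ} (hr : Function.Injective r) :
    Function.Injective (vertexRank r) := by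
  rintro ⟨u, a⟩ ⟨v, b⟩ h
  simp only [vertexRank] at h
  have h1 : u = v := hr (by omega)
  subst h1
  have h2 : a = b := Fin.ext (by omega)
  rw [h2]

variable {k : Type*} [Field k]

/-- The sign with which the vertex over `v` is removed from a facet. -/
def facetSign (k : Type*) [Field k] (r : ι → ℕ) (v : ι) : k :=
  ∏ u, if r u < r v then -1 else 1

/-- `vertexRank` compares base points first, so the sign does not depend on `f`. Hence the two
facets through a ridge carry the same incidence sign. -/
lemma koszulSign_graphFinset {r : ι → ℕ} (hr : Function.Injective r) (f : ι → Fin 2) (v : ι) :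
    koszulSign k (vertexRank r) (graphFinset f) (v, f v) = facetSign k r v := by
  rw [koszulSign, graphFinset, Finset.prod_map]
  refine Finset.prod_congr rfl fun u _ => ?_
  simp only [graphEmbedding_apply, vertexRank]
  congr 1
  by_cases h : u = v
  · subst h; simp
  · have := hr.ne h
    apply propext
    omega

lemma facetSign_ne_zero {r : ι → ℕ} (hr : Function.Injective r) (v : ι) : facetSign k r v ≠ 0 := by
  rw [← koszulSign_graphFinset hr 0]
  exact koszulSign_ne_zero _ _ _

variable {W : Type*} [AddCommGroup W] [Module k W]

lemma koszulBoundary_graphFinset {r : ι → ℕ} (hr : Function.Injective r)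
    (c : Finset (ι × Fin 2) → W) (f : ι → Fin 2) :
    koszulBoundary k W (vertexRank r) c (graphFinset f)
      = ∑ v, facetSign k r v • c ((graphFinset f).erase (v, f v)) := by
  rw [koszulBoundary_apply]
  nth_rw 1 [graphFinset]
  rw [Finset.sum_map]
  refine Finset.sum_congr rfl fun v _ => ?_
  rw [graphEmbedding_apply, koszulSign_graphFinset hr]

/-- The fundamental cycle of the cross-polytope annihilates coboundaries. -/
lemma sum_sign_koszulBoundary_graphFinset {r : ι → ℕ} (hr : Function.Injective r)
    (c : Finset (ι × Fin 2) → W) :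
    ∑ f : ι → Fin 2, (∏ v, if f v = 0 then 1 else (-1 : k)) •
      koszulBoundary k W (vertexRank r) c (graphFinset f) = 0 := by
  simp only [koszulBoundary_graphFinset hr, Finset.smul_sum]
  rw [Finset.sum_comm]
  refine Finset.sum_eq_zero fun v _ => ?_
  have flip : ∀ a : Fin 2, 1 - (1 - a) = a := by decide
  have flip_ne : ∀ a : Fin 2, 1 - a ≠ a := by decide
  have flip_sign : ∀ a : Fin 2,
      (if 1 - a = 0 then 1 else (-1 : k)) = -(if a = 0 then 1 else -1) := by
    intro a
    fin_cases a <;> simp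
  -- Flipping the value at `v` preserves the ridge opposite `v` and reverses the sign of the facet,
  -- so the terms cancel in pairs.
  refine Finset.sum_involution (fun f _ => Function.update f v (1 - f v)) ?_ ?_ ?_ ?_
  · intro f _
    have h1 : (graphFinset (Function.update f v (1 - f v))).erase
        (v, Function.update f v (1 - f v) v) = (graphFinset f).erase (v, f v) :=
      graphFinset_erase_congr fun u hu => Function.update_of_ne hu _ _
    have h2 : (∏ u, if Function.update f v (1 - f v) u = 0 then 1 else (-1 : k))
        = -∏ u, if f u = 0 then 1 else (-1 : k) := by
      rw [← Finset.mul_prod_erase _ _ (Finset.mem_univ v),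
        ← Finset.mul_prod_erase _ (fun u => if f u = 0 then 1 else (-1 : k)) (Finset.mem_univ v),
        Function.update_self, flip_sign, neg_mul]
      congr 2
      refine Finset.prod_congr rfl fun u hu => ?_
      rw [Function.update_of_ne (Finset.ne_of_mem_erase hu)]
    rw [h1, h2, neg_smul, add_neg_cancel]
  · intro f _ _ h
    have := congrFun h v
    rw [Function.update_self] at this
    exact flip_ne _ this
  · intro f _
    exact Finset.mem_univ _
  · intro f _
    simp [flip]

variable {J : Type*}

/-- The facet cochains which are coboundaries away from one missing facet. -/
lemma exists_koszulBoundary_graphFinset {r : ι → ℕ} (hr : Function.Injective r) {D : Set (ι → Fin 2)}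
    (hD : D ≠ Set.univ) (y : (ι → Fin 2) → W) :
    ∃ w : Finset (ι × Fin 2) → W, (∀ B, w B ≠ 0 → B.card + 1 = Fintype.card ι) ∧
      ∀ f ∈ D, koszulBoundary k W (vertexRank r) w (graphFinset f) = y f := by
  classical
  obtain ⟨g, hg⟩ := (Set.ne_univ_iff_exists_notMem _).1 hD
  let E : Submodule k ((ι → Fin 2) → W) :=
    { carrier := {y | ∃ w : Finset (ι × Fin 2) → W,
        (∀ B, w B ≠ 0 → B.card + 1 = Fintype.card ι) ∧
        ∀ f ∈ D, koszulBoundary k W (vertexRank r) w (graphFinset f) = y f}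
      add_mem' := by
        rintro y y' ⟨w, hw, h⟩ ⟨w', hw', h'⟩
        refine ⟨w + w', fun B hB => ?_, fun f hf => ?_⟩
        · by_cases h0 : w B = 0
          · exact hw' B fun h1 => hB (by simp [h0, h1])
          · exact hw B h0
        · rw [map_add, Pi.add_apply, h f hf, h' f hf, Pi.add_apply]
      zero_mem' := ⟨0, fun B hB => absurd rfl hB, fun f _ => by rw [map_zero]; rfl⟩
      smul_mem' := by
        rintro a y ⟨w, hw, h⟩
        refine ⟨a • w, fun B hB => hw B fun h0 => hB (by simp [h0]), fun f hf => ?_⟩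
        rw [map_smul, Pi.smul_apply, h f hf, Pi.smul_apply] }
  -- Induction on a set `T` outside which `f` agrees with the missing facet `g`. A cochain supported
  -- at `g` is invisible on `D`.
  have key : ∀ T : Finset ι, ∀ f : ι → Fin 2, (∀ v, v ∉ T → f v = g v) → ∀ x : W,
      Pi.single f x ∈ E := by
    intro T
    induction T using Finset.induction_on with
    | empty =>
      intro f hf x
      obtain rfl : f = g := funext fun v => hf v (Finset.notMem_empty v)
      refine ⟨0, fun B hB => absurd rfl hB, fun h hh => ?_⟩
      rw [map_zero, Pi.single_eq_of_ne (fun e : h = f => hg (e ▸ hh)), Pi.zero_apply]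
    | insert v T _ ih =>
      intro f hf x
      set f' := Function.update f v (g v) with hf'
      have hf'T : ∀ u, u ∉ T → f' u = g u := by
        intro u hu
        by_cases huv : u = v
        · rw [hf', huv, Function.update_self]
        · rw [hf', Function.update_of_ne huv, hf u (by simp [huv, hu])]
      have hEf' := ih f' hf'T x
      by_cases hv : f v = g v
      · rwa [hf', ← hv, Function.update_eq_self] at hEf'
      have hne : f' ≠ f := fun h => hv (by rw [← h, hf', Function.update_self])
      have hoff : ∀ h : ι → Fin 2, (∀ w, w ≠ v → h w = f w) ↔ h = f ∨ h = f' := by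
        intro h
        constructor
        · intro hw
          have two : ∀ a b c : Fin 2, a ≠ b → c = a ∨ c = b := by decide
          rcases two _ _ (h v) hv with e | e
          · left
            funext u
            by_cases hu : u = v
            · rw [hu, e]
            · exact hw u hu
          · right
            funext u
            by_cases hu : u = v
            · rw [hu, e, hf', Function.update_self]
            · rw [hw u hu, hf', Function.update_of_ne hu]
        · rintro (rfl | rfl) w hw
          · rfl
          · exact Function.update_of_ne hw _ _
      -- The ridge shared by `f` and `f'` has coboundary supported on these two facets, with equal
      -- signs. Thus `f` may be traded for `f'`, which is closer to `g`.
      have hsum : Pi.single f x + Pi.single f' x ∈ E := by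
        refine ⟨Pi.single ((graphFinset f).erase (v, f v)) ((facetSign k r v)⁻¹ • x),
          fun B hB => ?_, fun h _ => ?_⟩
        · by_cases hB' : B = (graphFinset f).erase (v, f v)
          · rw [hB', Finset.card_erase_add_one (mem_graphFinset.2 rfl), card_graphFinset]
          · exact absurd (Pi.single_eq_of_ne hB' _) hB
        · rw [koszulBoundary_graphFinset hr, Finset.sum_eq_single v]
          · simp only [Pi.single_apply, graphFinset_erase_eq_iff, true_and, hoff, Pi.add_apply]
            by_cases h1 : h = f
            · have h2 : h ≠ f' := h1 ▸ hne.symm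
              simp [h1, hne.symm, smul_smul, facetSign_ne_zero hr]
            · by_cases h2 : h = f'
              · simp [h2, hne, smul_smul, facetSign_ne_zero hr]
              · simp [h1, h2]
          · intro u _ hu
            rw [Pi.single_eq_of_ne, smul_zero]
            rw [Ne, graphFinset_erase_eq_iff]
            exact fun h => hu h.1
          · exact fun h => absurd (Finset.mem_univ v) h
      simpa using E.sub_mem hsum hEf'
  have hy : y ∈ E := by
    rw [← Finset.univ_sum_single y]
    exact Submodule.sum_mem _ fun f _ => key Finset.univ f (fun v hv => absurd (Finset.mem_univ v) hv) _
  exact hy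

/-- The Koszul homology of the Stanley-Reisner ideal of a suboplex in the degree of all vertices
vanishes exactly when the suboplex is not the whole cross-polytope. -/
lemma koszulExactAt_suboplex_iff [Nonempty ι] [Nonempty J] {r : ι → ℕ} (hr : Function.Injective r)
    {D : Set (ι → Fin 2)} {M : Finset (ι × Fin 2) → Submodule k (J → k)}
    (hbot : ∀ B, (∃ f ∈ D, ∀ p ∈ B, f p.1 = p.2) → M B = ⊥)
    (htop : ∀ B, (¬ ∃ f ∈ D, ∀ p ∈ B, f p.1 = p.2) → M B = ⊤) :
    KoszulExactAt (vertexRank r) M (Fintype.card ι - 1) ↔ D ≠ Set.univ := by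
  classical
  have hρ := vertexRank_injective hr
  have hcard : Fintype.card (ι × Fin 2) = Fintype.card ι + Fintype.card ι := by
    rw [Fintype.card_prod, Fintype.card_fin, mul_two]
  have hpos : 0 < Fintype.card ι := Fintype.card_pos
  obtain ⟨u, hu⟩ : ∃ u, Fintype.card ι = u + 1 := ⟨Fintype.card ι - 1, by omega⟩
  rw [hu, Nat.add_sub_cancel]
  let P : J → Finset (ι × Fin 2) → Prop := fun _ _ => True
  have hP : ∀ j, Monotone (P j) := fun _ _ _ _ => id
  have memV : ∀ B (v : J → k), v ∈ coordinateFiltration k P B := fun _ _ _ _ => trivial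
  have acyclic : ∀ p (c : Finset (ι × Fin 2) → J → k),
      IsKoszulChain (coordinateFiltration k P) p c → koszulBoundary k _ (vertexRank r) c = 0 →
      ∃ c', IsKoszulChain (coordinateFiltration k P) (p + 1) c' ∧
        koszulBoundary k _ (vertexRank r) c' = c := fun p c hc h0 =>
    exists_koszulBoundary_eq hρ hc h0 fun _ => Or.inl ⟨Classical.arbitrary _, fun _ _ => trivial⟩
  constructor
  · rintro hex rfl
    let y : Finset (ι × Fin 2) → J → k := Pi.single (graphFinset 0) 1
    have hy : IsKoszulChain (coordinateFiltration k P) (u + 1) y := by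
      refine ⟨fun B => memV B _, fun B hB => ?_⟩
      by_cases h : B = graphFinset 0
      · rw [h, card_graphFinset]; omega
      · exact absurd (Pi.single_eq_of_ne h _) hB
    have hb := hy.boundary (ρ := vertexRank r) (coordinateFiltration_mono hP)
    obtain ⟨c', hc', h⟩ := hex _ ⟨fun B => by
        by_cases h0 : koszulBoundary k _ (vertexRank r) y B = 0
        · rw [h0]; exact Submodule.zero_mem _
        -- Here `B` has `|ι| + 1` elements, too many to lie in a graph.
        · rw [htop]
          · trivial
          · rintro ⟨f, -, hf⟩
            have h1 := hb.card B h0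
            have h2 := Finset.card_le_card (fun p hp => mem_graphFinset.2 (hf p hp) :
              B ⊆ graphFinset f)
            rw [card_graphFinset] at h2
            omega, hb.card⟩ (koszulBoundary_koszulBoundary hρ y)
    obtain ⟨w, -, hw⟩ := acyclic (u + 1) (y - c') (hy.sub ⟨fun B => memV B _, hc'.card⟩)
      (by rw [map_sub, h, sub_self])
    -- Since `c'` vanishes on every facet, pairing `y - c' = ∂w` with the fundamental cycle leaves
    -- the nonzero value of `y` at the graph of `0`.
    have h1 := sum_sign_koszulBoundary_graphFinset (k := k) hr w
    rw [hw, Finset.sum_eq_single 0] at h1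
    · have h2 := hc'.mem (graphFinset 0)
      rw [hbot _ ⟨0, trivial, fun p hp => mem_graphFinset.1 hp⟩, Submodule.mem_bot] at h2
      simp [y, h2] at h1
    · intro f _ hf
      have h2 := hc'.mem (graphFinset f)
      rw [hbot _ ⟨f, trivial, fun p hp => mem_graphFinset.1 hp⟩, Submodule.mem_bot] at h2
      have h3 : graphFinset f ≠ graphFinset 0 := fun e => hf <| funext fun v => by
        have : (v, f v) ∈ graphFinset f := mem_graphFinset.2 rfl
        rw [e] at this
        exact (mem_graphFinset.1 this).symm
      rw [Pi.sub_apply, h2, sub_zero, show y (graphFinset f) = 0 from Pi.single_eq_of_ne h3 _,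
        smul_zero]
    · exact fun h => absurd (Finset.mem_univ _) h
  · intro hD c hc h0
    obtain ⟨y, hy, rfl⟩ := acyclic u c ⟨fun B => memV B _, hc.card⟩ h0
    obtain ⟨w, hw, hwD⟩ := exists_koszulBoundary_graphFinset (k := k) hr hD fun f => y (graphFinset f)
    have hwV : IsKoszulChain (coordinateFiltration k P) (u + 1 + 1) w :=
      ⟨fun B => memV B _, fun B hB => by have := hw B hB; omega⟩
    have hdiff := hy.sub (hwV.boundary (ρ := vertexRank r) (coordinateFiltration_mono hP))
    refine ⟨y - koszulBoundary k _ (vertexRank r) w, ⟨fun B => ?_, hdiff.card⟩, ?_⟩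
    · by_cases hne : (y - koszulBoundary k _ (vertexRank r) w) B = 0
      · rw [hne]; exact Submodule.zero_mem _
      · by_cases hB : ∃ f ∈ D, ∀ p ∈ B, f p.1 = p.2
        · obtain ⟨f, hf, hfB⟩ := hB
          have h1 := hdiff.card B hne
          -- A face with `|ι|` elements is a whole facet, and there `w` was chosen to cancel `y`.
          obtain rfl := eq_graphFinset hfB (by omega)
          exact absurd (by rw [Pi.sub_apply, hwD f hf, sub_self]) hne
        · rw [htop B hB]; trivial
    · rw [map_sub, koszulBoundary_koszulBoundary hρ, sub_zero]

end Suboplex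

/-! ### Graded pieces of maps of free modules, as linear algebra over the field -/

section Graded

open MvPolynomial

variable {k : Type*} [Field k] {σ : Type*} {J L K : Type*}

/-- The vectors of `k^J` which are the coefficient vectors of elements of degree `b` in the free
module `⨁_j S(-deg j)`. -/
abbrev degreeFiltration (k : Type*) [Field k] {σ J : Type*} (deg : J → σ →₀ ℕ) (b : σ →₀ ℕ) :
    Submodule k (J → k) :=
  coordinateFiltration k (fun j b => deg j ≤ b) b

open Classical in
/-- The coefficient vector of the component of degree `b` of an element of `⨁_j S(-deg j)`. -/
noncomputable def degreePart (deg : J → σ →₀ ℕ) (b : σ →₀ ℕ) :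
    (J → MvPolynomial σ k) →ₗ[k] (J → k) where
  toFun w j := if deg j ≤ b then coeff (b - deg j) (w j) else 0
  map_add' w w' := by
    funext j
    by_cases h : deg j ≤ b <;> simp [h]
  map_smul' r w := by
    funext j
    by_cases h : deg j ≤ b <;> simp [h]

open Classical in
/-- The element of degree `b` of `⨁_j S(-deg j)` with a given coefficient vector. -/
noncomputable def homogenize (deg : J → σ →₀ ℕ) (b : σ →₀ ℕ) :
    (J → k) →ₗ[k] (J → MvPolynomial σ k) where
  toFun v j := if deg j ≤ b then monomial (b - deg j) (v j) else 0
  map_add' w w' := by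
    funext j
    by_cases h : deg j ≤ b <;> simp [h]
  map_smul' r w := by
    funext j
    by_cases h : deg j ≤ b <;> simp [h, smul_monomial]

lemma degreePart_of_le {deg : J → σ →₀ ℕ} {b : σ →₀ ℕ} {j : J} (h : deg j ≤ b)
    (w : J → MvPolynomial σ k) : degreePart deg b w j = coeff (b - deg j) (w j) := if_pos h

lemma degreePart_of_not_le {deg : J → σ →₀ ℕ} {b : σ →₀ ℕ} {j : J} (h : ¬ deg j ≤ b)
    (w : J → MvPolynomial σ k) : degreePart deg b w j = 0 := if_neg h

lemma homogenize_of_le {deg : J → σ →₀ ℕ} {b : σ →₀ ℕ} {j : J} (h : deg j ≤ b) (v : J → k) :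
    homogenize deg b v j = monomial (b - deg j) (v j) := if_pos h

lemma homogenize_of_not_le {deg : J → σ →₀ ℕ} {b : σ →₀ ℕ} {j : J} (h : ¬ deg j ≤ b)
    (v : J → k) : homogenize deg b v j = 0 := if_neg h

lemma degreePart_zero (b : σ →₀ ℕ) (w : J → MvPolynomial σ k) (j : J) :
    degreePart (0 : J → σ →₀ ℕ) b w j = coeff b (w j) :=
  (degreePart_of_le (deg := 0) (j := j) (zero_le (a := b)) w).trans
    (by rw [Pi.zero_apply, tsub_zero])

lemma homogenize_zero (b : σ →₀ ℕ) (v : J → k) (j : J) :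
    homogenize (0 : J → σ →₀ ℕ) b v j = monomial b (v j) :=
  (homogenize_of_le (deg := 0) (j := j) (zero_le (a := b)) v).trans
    (by rw [Pi.zero_apply, tsub_zero])

lemma degreePart_mem (deg : J → σ →₀ ℕ) (b : σ →₀ ℕ) (w : J → MvPolynomial σ k) :
    degreePart deg b w ∈ degreeFiltration k deg b := fun j hj => by
  by_contra h
  exact hj (degreePart_of_not_le h w)

lemma degreePart_homogenize {deg : J → σ →₀ ℕ} {b : σ →₀ ℕ} {v : J → k}
    (hv : v ∈ degreeFiltration k deg b) : degreePart deg b (homogenize deg b v) = v := by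
  classical
  funext j
  by_cases h : deg j ≤ b
  · rw [degreePart_of_le h, homogenize_of_le h, coeff_monomial, if_pos rfl]
  · rw [degreePart_of_not_le h]
    by_contra hne
    exact h (hv j (Ne.symm hne))

lemma degreePart_homogenize_of_ne (deg : J → σ →₀ ℕ) {b b' : σ →₀ ℕ} (hb : b' ≠ b) (v : J → k) :
    degreePart deg b' (homogenize deg b v) = 0 := by
  classical
  funext j
  by_cases h' : deg j ≤ b'
  · rw [degreePart_of_le h']
    by_cases h : deg j ≤ b
    · rw [homogenize_of_le h, coeff_monomial, if_neg, Pi.zero_apply]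
      intro e
      rw [← tsub_add_cancel_of_le h, e, tsub_add_cancel_of_le h'] at hb
      exact hb rfl
    · rw [homogenize_of_not_le h, coeff_zero, Pi.zero_apply]
  · rw [degreePart_of_not_le h', Pi.zero_apply]

lemma eq_zero_of_degreePart (deg : J → σ →₀ ℕ) {w : J → MvPolynomial σ k}
    (h : ∀ b, degreePart deg b w = 0) : w = 0 := by
  funext j
  ext m
  have := congrFun (h (m + deg j)) j
  rw [degreePart_of_le (self_le_add_left _ _), add_tsub_cancel_right] at this
  simpa using this

/-- Homomorphisms of free modules preserving multidegrees. -/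
def IsGradedMap (degJ : J → σ →₀ ℕ) (degL : L → σ →₀ ℕ) [DecidableEq J]
    (f : (J → MvPolynomial σ k) →ₗ[MvPolynomial σ k] (L → MvPolynomial σ k)) : Prop :=
  ∀ j l a, coeff a (f (Pi.single j 1) l) ≠ 0 → a + degL l = degJ j

/-- The matrix over `k` obtained from a map of free modules by setting all variables to `1`. -/
noncomputable def dehomogenize
    (f : (J → MvPolynomial σ k) →ₗ[MvPolynomial σ k] (L → MvPolynomial σ k)) :
    (J → k) →ₗ[k] (L → k) where
  toFun v l := eval 1 (f (fun j => C (v j)) l)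
  map_add' v v' := by
    funext l
    rw [show (fun j => C ((v + v') j)) = (fun j => (C (v j) : MvPolynomial σ k)) + fun j => C (v' j)
      from funext fun j => C_add, map_add]
    simp
  map_smul' r v := by
    funext l
    rw [show (fun j => C ((r • v) j)) = (C r : MvPolynomial σ k) • fun j => (C (v j) : MvPolynomial σ k)
      from funext fun j => C_mul, map_smul]
    simp

variable [DecidableEq J] [Fintype J] {degJ : J → σ →₀ ℕ} {degL : L → σ →₀ ℕ}
  {f : (J → MvPolynomial σ k) →ₗ[MvPolynomial σ k] (L → MvPolynomial σ k)}

/-- Each matrix entry of a graded map is a scalar times one monomial, whose exponent is forced by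
the degrees. One scalar matrix therefore describes the map in every degree `b`. -/
lemma degreePart_map (hf : IsGradedMap degJ degL f) (b : σ →₀ ℕ) (w : J → MvPolynomial σ k) :
    degreePart degL b (f w) = dehomogenize f (degreePart degJ b w) := by
  classical
  suffices h : (degreePart degL b).comp (f.restrictScalars k)
      = (dehomogenize f).comp (degreePart degJ b) from LinearMap.congr_fun h w
  refine LinearMap.pi_ext' fun j => MvPolynomial.linearMap_ext fun m => LinearMap.ext_ring ?_
  funext l
  have hpart : degreePart degJ b (Pi.single j (monomial m (1 : k)))
      = if m + degJ j = b then Pi.single j 1 else 0 := by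
    funext i
    by_cases hij : i = j
    · subst hij
      by_cases h : degJ i ≤ b
      · rw [degreePart_of_le h, Pi.single_eq_same, coeff_monomial]
        by_cases hm : m + degJ i = b
        · rw [if_pos hm, if_pos (by rw [← hm, add_tsub_cancel_right]), Pi.single_eq_same]
        · rw [if_neg hm, if_neg, Pi.zero_apply]
          intro e
          exact hm (by rw [e, tsub_add_cancel_of_le h])
      · rw [degreePart_of_not_le h, if_neg, Pi.zero_apply]
        rintro rfl
        exact h (self_le_add_left _ _)
    · have : degreePart degJ b (Pi.single j (monomial m (1 : k))) i = 0 := by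
        by_cases h : degJ i ≤ b
        · rw [degreePart_of_le h, Pi.single_eq_of_ne hij, coeff_zero]
        · rw [degreePart_of_not_le h]
      rw [this]
      split_ifs
      · rw [Pi.single_eq_of_ne hij]
      · rfl
  have hsingle : f (Pi.single j (monomial m 1)) = monomial m (1 : k) • f (Pi.single j 1) := by
    rw [← map_smul, ← Pi.single_smul, smul_eq_mul, mul_one]
  have hone : (fun i => C ((Pi.single j 1 : J → k) i)) = (Pi.single j 1 : J → MvPolynomial σ k) := by
    funext i
    by_cases hij : i = j
    · subst hij; simp
    · simp [hij]
  simp only [LinearMap.comp_apply, LinearMap.single_apply, LinearMap.restrictScalars_apply]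
  rw [hpart, hsingle]
  -- Homogeneity determines the exponent of any nonzero coefficient; for a zero entry the exponent
  -- is arbitrary.
  have hq : ∃ a c, f (Pi.single j 1) l = monomial a c ∧ (c ≠ 0 → a + degL l = degJ j) := by
    by_cases h0 : f (Pi.single j 1) l = 0
    · exact ⟨0, 0, by simp [h0], fun h => absurd rfl h⟩
    · obtain ⟨a, ha⟩ := MvPolynomial.exists_coeff_ne_zero h0
      refine ⟨a, coeff a (f (Pi.single j 1) l), ?_, fun _ => hf j l a ha⟩
      ext m'
      rw [coeff_monomial]
      split_ifs with h
      · rw [h]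
      · by_contra hne
        exact h (add_right_cancel ((hf j l a ha).trans (hf j l m' hne).symm))
  obtain ⟨a, c, hac, hdeg⟩ := hq
  have hR : dehomogenize f (if m + degJ j = b then Pi.single j 1 else 0) l
      = if m + degJ j = b then c else 0 := by
    split_ifs
    · change eval 1 (f (fun i => C ((Pi.single j 1 : J → k) i)) l) = c
      rw [hone, hac, eval_monomial]
      simp
    · rw [map_zero, Pi.zero_apply]
  rw [hR]
  by_cases hc : c = 0
  · by_cases h : degL l ≤ b
    · rw [degreePart_of_le h, Pi.smul_apply, hac, hc]; simp
    · rw [degreePart_of_not_le h, hc, ite_self]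
  · have hd := hdeg hc
    by_cases h : degL l ≤ b
    · rw [degreePart_of_le h, Pi.smul_apply, hac, smul_eq_mul, monomial_mul, one_mul, coeff_monomial]
      refine if_congr ⟨fun e => ?_, fun e => ?_⟩ rfl rfl
      · rw [← hd, ← add_assoc, e, tsub_add_cancel_of_le h]
      · rw [← e, ← hd, ← add_assoc, add_tsub_cancel_right]
    · rw [degreePart_of_not_le h, if_neg]
      rintro rfl
      refine h (hd ▸ ?_)
      rw [← add_assoc]
      exact self_le_add_left _ _

lemma map_homogenize_eq_zero (hf : IsGradedMap degJ degL f) {b : σ →₀ ℕ} {v : J → k}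
    (hv : v ∈ degreeFiltration k degJ b) (h : dehomogenize f v = 0) :
    f (homogenize degJ b v) = 0 := by
  refine eq_zero_of_degreePart degL fun b' => ?_
  rw [degreePart_map hf]
  by_cases hb : b' = b
  · rw [hb, degreePart_homogenize hv, h]
  · rw [degreePart_homogenize_of_ne _ hb, map_zero]

lemma map_dehomogenize (hf : IsGradedMap degJ degL f) (b : σ →₀ ℕ) :
    (degreeFiltration k degJ b).map (dehomogenize f)
      = ((LinearMap.range f).restrictScalars k).map (degreePart degL b) := by
  ext v
  constructor
  · rintro ⟨v, hv, rfl⟩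
    exact ⟨f (homogenize degJ b v), ⟨_, rfl⟩, by rw [degreePart_map hf, degreePart_homogenize hv]⟩
  · rintro ⟨_, ⟨w, rfl⟩, rfl⟩
    exact ⟨_, degreePart_mem degJ b w, (degreePart_map hf b w).symm⟩

lemma map_dehomogenize_eq_inf_ker [DecidableEq K] [Fintype K] {degK : K → σ →₀ ℕ}
    {g : (K → MvPolynomial σ k) →ₗ[MvPolynomial σ k] (J → MvPolynomial σ k)}
    (hf : IsGradedMap degJ degL f) (hg : IsGradedMap degK degJ g)
    (hfg : LinearMap.range g = LinearMap.ker f) (b : σ →₀ ℕ) :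
    (degreeFiltration k degK b).map (dehomogenize g)
      = degreeFiltration k degJ b ⊓ LinearMap.ker (dehomogenize f) := by
  rw [map_dehomogenize hg, hfg]
  ext v
  constructor
  · rintro ⟨w, hw, rfl⟩
    refine ⟨degreePart_mem degJ b w, ?_⟩
    have hw : f w = 0 := hw
    change dehomogenize f (degreePart degJ b w) = 0
    rw [← degreePart_map hf, hw, map_zero]
  · rintro ⟨hv, h⟩
    exact ⟨homogenize degJ b v, map_homogenize_eq_zero hf hv h, degreePart_homogenize hv⟩

end Graded

/-! ### Existence of minimal multigraded free resolutions -/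

section MinimalResolution

open MvPolynomial

variable {k : Type*} [Field k] {σ : Type*} {J L : Type*}

/-- A submodule of a multigraded free module is graded if it contains the homogeneous components of
its elements. -/
def IsGradedSubmodule (deg : J → σ →₀ ℕ)
    (N : Submodule (MvPolynomial σ k) (J → MvPolynomial σ k)) : Prop :=
  ∀ w ∈ N, ∀ b, homogenize deg b (degreePart deg b w) ∈ N

lemma IsGradedMap.ker [Fintype J] [DecidableEq J] {degJ : J → σ →₀ ℕ} {degL : L → σ →₀ ℕ}
    {f : (J → MvPolynomial σ k) →ₗ[MvPolynomial σ k] (L → MvPolynomial σ k)}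
    (hf : IsGradedMap degJ degL f) : IsGradedSubmodule degJ (LinearMap.ker f) := by
  intro w hw b
  refine map_homogenize_eq_zero hf (degreePart_mem degJ b w) ?_
  rw [← degreePart_map hf, LinearMap.mem_ker.1 hw, map_zero]

lemma sum_homogenize_degreePart [Fintype J] (deg : J → σ →₀ ℕ) (w : J → MvPolynomial σ k) :
    ∃ T : Finset (σ →₀ ℕ), ∑ b ∈ T, homogenize deg b (degreePart deg b w) = w := by
  classical
  refine ⟨Finset.univ.biUnion fun j => (w j).support.image (· + deg j), ?_⟩
  funext j
  ext m
  rw [Finset.sum_apply, coeff_sum, Finset.sum_eq_single (m + deg j)]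
  · rw [homogenize_of_le (self_le_add_left _ _), degreePart_of_le (self_le_add_left _ _),
      add_tsub_cancel_right, coeff_monomial, if_pos rfl]
  · intro b _ hb
    by_cases h : deg j ≤ b
    · rw [homogenize_of_le h, coeff_monomial, if_neg]
      intro e
      exact hb (by rw [← e, tsub_add_cancel_of_le h])
    · rw [homogenize_of_not_le h, coeff_zero]
  · intro h
    rw [homogenize_of_le (self_le_add_left _ _), degreePart_of_le (self_le_add_left _ _),
      add_tsub_cancel_right, coeff_monomial, if_pos rfl]
    by_contra hne
    refine h (Finset.mem_biUnion.2 ⟨j, Finset.mem_univ j, Finset.mem_image.2 ⟨m, ?_, rfl⟩⟩)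
    exact mem_support_iff.2 hne

/-- Finitely generated graded submodules have minimal homogeneous free covers. -/
lemma exists_minimal_free_cover [Finite σ] [Fintype L] (degL : L → σ →₀ ℕ)
    (N : Submodule (MvPolynomial σ k) (L → MvPolynomial σ k)) (hN : IsGradedSubmodule degL N) :
    ∃ (r : ℕ) (deg : Fin r → σ →₀ ℕ)
      (f : (Fin r → MvPolynomial σ k) →ₗ[MvPolynomial σ k] (L → MvPolynomial σ k)),
      IsGradedMap deg degL f ∧ LinearMap.range f = N ∧
        ∀ v ∈ LinearMap.ker f, ∀ j, constantCoeff (v j) = 0 := by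
  classical
  let X : Set (L → MvPolynomial σ k) := {u | u ∈ N ∧ ∃ b v, homogenize degL b v = u}
  have hX : Submodule.span (MvPolynomial σ k) X = N := by
    refine le_antisymm (Submodule.span_le.2 fun u hu => hu.1) fun w hw => ?_
    obtain ⟨T, hT⟩ := sum_homogenize_degreePart degL w
    rw [← hT]
    exact Submodule.sum_mem _ fun b _ => Submodule.subset_span ⟨hN w hw b, b, _, rfl⟩
  -- A homogeneous generating set of least cardinality will give the minimal cover.
  have hex : ∃ n, ∃ G : Finset (L → MvPolynomial σ k), (G : Set (L → MvPolynomial σ k)) ⊆ X ∧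
      Submodule.span (MvPolynomial σ k) (G : Set (L → MvPolynomial σ k)) = N ∧ G.card = n := by
    obtain ⟨G, hG, h⟩ := (Submodule.fg_span_iff_fg_span_finset_subset X).1
      (hX ▸ IsNoetherian.noetherian N)
    exact ⟨_, G, hG, h ▸ hX, rfl⟩
  obtain ⟨G, hGX, hGN, hGcard⟩ := Nat.find_spec hex
  have hmin : ∀ G' : Finset (L → MvPolynomial σ k), (G' : Set (L → MvPolynomial σ k)) ⊆ X →
      Submodule.span (MvPolynomial σ k) (G' : Set (L → MvPolynomial σ k)) = N →
      G.card ≤ G'.card := fun G' h h' => by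
    rw [hGcard]
    exact Nat.find_min' hex ⟨G', h, h', rfl⟩
  let e : Fin G.card ≃ G := G.equivFin.symm
  choose deg v hv using fun j => (hGX (e j).2).2
  let f := Fintype.linearCombination (MvPolynomial σ k) fun j => (e j : L → MvPolynomial σ k)
  have hfgr : IsGradedMap deg degL f := by
    intro j l a ha
    rw [Fintype.linearCombination_apply_single, one_smul, ← hv j] at ha
    by_cases h : degL l ≤ deg j
    · rw [homogenize_of_le h, coeff_monomial] at ha
      have := (ite_ne_right_iff.1 ha).1
      rw [← this, tsub_add_cancel_of_le h]
    · rw [homogenize_of_not_le h, coeff_zero] at ha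
      exact absurd rfl ha
  refine ⟨G.card, deg, f, hfgr, ?_, ?_⟩
  · rw [Fintype.range_linearCombination, ← hGN]
    congr 1
    ext u
    exact ⟨fun ⟨j, hj⟩ => hj ▸ (e j).2, fun hu => ⟨e.symm ⟨u, hu⟩, by simp⟩⟩
  · intro w hw j
    by_contra hne
    -- In the component of degree `deg j`, the `j`-th coordinate of the syzygy is a nonzero
    -- constant. The `j`-th generator is then redundant, against the choice of `G`.
    have hw' := hfgr.ker w hw (deg j)
    set u := homogenize deg (deg j) (degreePart deg (deg j) w) with hu
    have huj : u j = C (constantCoeff (w j)) := by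
      rw [hu, homogenize_of_le le_rfl, degreePart_of_le le_rfl, tsub_self]
      rfl
    set g : L → MvPolynomial σ k := (e j).1 with hg
    set A := Submodule.span (MvPolynomial σ k) ((G.erase g : Finset _) : Set (L → MvPolynomial σ k))
      with hA
    have hrest : ∀ i, i ≠ j → u i • (e i : L → MvPolynomial σ k) ∈ A := fun i hi =>
      Submodule.smul_mem _ _ (Submodule.subset_span (Finset.mem_coe.2 (Finset.mem_erase.2
        ⟨fun h => hi (e.injective (Subtype.ext h)), (e i).2⟩)))
    have hgA : g ∈ A := by
      have h0 : ∑ i, u i • (e i : L → MvPolynomial σ k) = 0 := hw'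
      rw [← Finset.add_sum_erase _ _ (Finset.mem_univ j), huj] at h0
      have h1 : (C (constantCoeff (w j)) : MvPolynomial σ k) • g ∈ A := by
        rw [eq_neg_of_add_eq_zero_left h0]
        exact A.neg_mem (Submodule.sum_mem _ fun i hi => hrest i (Finset.ne_of_mem_erase hi))
      have h2 := A.smul_mem (C (constantCoeff (w j))⁻¹) h1
      rwa [smul_smul, ← C_mul, inv_mul_cancel₀ hne, C_1, one_smul] at h2
    have hgG : g ∈ G := (e j).2
    have hspan : A = N := by
      rw [← hGN]
      refine le_antisymm (Submodule.span_mono (Finset.coe_subset.2 (Finset.erase_subset g G)))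
        (Submodule.span_le.2 fun x hx => ?_)
      by_cases hxg : x = g
      · exact hxg ▸ hgA
      · exact Submodule.subset_span (Finset.mem_coe.2 (Finset.mem_erase.2 ⟨hxg, hx⟩))
    have := hmin (G.erase g) (fun x hx => hGX (Finset.mem_of_mem_erase hx)) hspan
    have := Finset.card_erase_lt_of_mem hgG
    omega

/-- A graded submodule of a finite free module, as one stage of the construction of a resolution. -/
structure Syzygy (k : Type*) [Field k] (σ : Type*) where
  /-- the rank of the ambient free module -/
  rank : ℕ
  /-- the degrees of its basis -/
  deg : Fin rank → σ →₀ ℕ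
  /-- the submodule -/
  module : Submodule (MvPolynomial σ k) (Fin rank → MvPolynomial σ k)
  /-- the submodule is graded -/
  graded : IsGradedSubmodule deg module

variable [Finite σ]

/-- The rank of a minimal cover. -/
noncomputable def Syzygy.coverRank (s : Syzygy k σ) : ℕ :=
  (exists_minimal_free_cover s.deg s.module s.graded).choose

/-- The degrees of the basis of a minimal cover. -/
noncomputable def Syzygy.coverDeg (s : Syzygy k σ) : Fin s.coverRank → σ →₀ ℕ :=
  (exists_minimal_free_cover s.deg s.module s.graded).choose_spec.choose

/-- The map of a minimal cover. -/
noncomputable def Syzygy.cover (s : Syzygy k σ) :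
    (Fin s.coverRank → MvPolynomial σ k) →ₗ[MvPolynomial σ k] (Fin s.rank → MvPolynomial σ k) :=
  (exists_minimal_free_cover s.deg s.module s.graded).choose_spec.choose_spec.choose

lemma Syzygy.cover_spec (s : Syzygy k σ) :
    IsGradedMap s.coverDeg s.deg s.cover ∧ LinearMap.range s.cover = s.module ∧
      ∀ v ∈ LinearMap.ker s.cover, ∀ j, constantCoeff (v j) = 0 :=
  (exists_minimal_free_cover s.deg s.module s.graded).choose_spec.choose_spec.choose_spec

/-- The kernel of a minimal cover. -/
noncomputable def Syzygy.next (s : Syzygy k σ) : Syzygy k σ where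
  rank := s.coverRank
  deg := s.coverDeg
  module := LinearMap.ker s.cover
  graded := s.cover_spec.1.ker

/-- The iterated syzygies. -/
noncomputable def Syzygy.iter (s : Syzygy k σ) : ℕ → Syzygy k σ
  | 0 => s
  | n + 1 => (s.iter n).next

omit [Finite σ] in
lemma coeff_ne_zero_of_proj {r : ℕ} {deg : Fin r → σ →₀ ℕ}
    {f : (Fin r → MvPolynomial σ k) →ₗ[MvPolynomial σ k] (Fin 1 → MvPolynomial σ k)}
    (hf : IsGradedMap deg 0 f) (j : Fin r) (a : σ →₀ ℕ)
    (h : coeff a (f (Pi.single j 1) 0) ≠ 0) : a = deg j := by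
  simpa using hf j 0 a h

/-- Existence of minimal multigraded free resolutions. -/
lemma nonempty_minimalFreeResolution {I : Ideal (MvPolynomial σ k)}
    (hI : IsGradedSubmodule (J := Fin 1) 0 (Submodule.comap (LinearMap.proj 0) I)) :
    Nonempty (MinimalFreeResolution I) := by
  let s : Syzygy k σ := ⟨1, 0, Submodule.comap (LinearMap.proj 0) I, hI⟩
  have h0 := s.cover_spec
  have hs : ∀ i, LinearMap.range (s.iter (i + 1)).cover = LinearMap.ker (s.iter i).cover :=
    fun i => (s.iter (i + 1)).cover_spec.2.1
  let pr : (Fin 1 → MvPolynomial σ k) →ₗ[MvPolynomial σ k] MvPolynomial σ k := LinearMap.proj 0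
  have hpr : LinearMap.ker pr = ⊥ := by
    refine LinearMap.ker_eq_bot'.2 fun v hv => funext fun i => ?_
    rw [Subsingleton.elim i 0]
    exact hv
  have hrange : LinearMap.range (pr.comp s.cover) = I := by
    refine (LinearMap.range_comp s.cover pr).trans ?_
    rw [h0.2.1]
    exact Submodule.map_comap_eq_of_surjective (fun x => ⟨fun _ => x, rfl⟩) I
  have hker : LinearMap.ker s.cover = LinearMap.ker (pr.comp s.cover) := by
    refine Eq.symm ((LinearMap.ker_comp s.cover pr).trans ?_)
    rw [hpr]
    rfl
  exact ⟨{
    rank := fun i => (s.iter i).coverRank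
    deg := fun i => (s.iter i).coverDeg
    ε := pr.comp s.cover
    d := fun i => (s.iter (i + 1)).cover
    ε_graded := fun j a h => coeff_ne_zero_of_proj h0.1 j a h
    d_graded := fun i j l a h => (s.iter (i + 1)).cover_spec.1 j l a h
    range_ε := hrange
    exact_zero := (hs 0).trans hker
    exact_succ := fun i => hs (i + 1)
    minimal := fun i j l => (s.iter i).cover_spec.2.2 _
      ((hs i).le ⟨_, rfl⟩) l }⟩

end MinimalResolution

/-! ### Comparison of degrees with squarefree degrees -/

section SquarefreeDegree

variable {σ : Type*}

lemma squarefreeDegree_apply [DecidableEq σ] (s : Finset σ) (i : σ) :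
    squarefreeDegree s i = if i ∈ s then 1 else 0 := by
  simp [squarefreeDegree, Finsupp.finsetSum_apply, Finsupp.single_apply]

lemma squarefreeDegree_le_iff {s t : Finset σ} :
    squarefreeDegree s ≤ squarefreeDegree t ↔ s ⊆ t := by
  classical
  constructor
  · intro h i hi
    have := h i
    rw [squarefreeDegree_apply, squarefreeDegree_apply, if_pos hi] at this
    by_contra hne
    rw [if_neg hne] at this
    omega
  · intro h i
    rw [squarefreeDegree_apply, squarefreeDegree_apply]
    by_cases hi : i ∈ s
    · rw [if_pos hi, if_pos (h hi)]
    · rw [if_neg hi]; exact Nat.zero_le _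

variable {α : Type*} [Fintype α] [DecidableEq α] (e : α ↪ σ)

/-- If `d` vanishes at some `e x`, erasing `x` costs nothing; otherwise every vertex is needed. This
dichotomy supplies the apex for the contraction of a free module. -/
lemma le_squarefreeDegree_erase_or (d : σ →₀ ℕ) :
    (∃ x, ∀ B : Finset α, d ≤ squarefreeDegree (B.map e) →
      d ≤ squarefreeDegree ((B.erase x).map e)) ∨
    ∀ B : Finset α, d ≤ squarefreeDegree (B.map e) → B = Finset.univ := by
  classical
  by_cases h : ∃ x, d (e x) = 0
  · obtain ⟨x, hx⟩ := h
    refine Or.inl ⟨x, fun B hB i => ?_⟩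
    by_cases hi : i = e x
    · rw [hi, hx]; exact Nat.zero_le _
    · refine (hB i).trans ?_
      rw [squarefreeDegree_apply, squarefreeDegree_apply]
      by_cases hm : i ∈ B.map e
      · obtain ⟨y, hy, rfl⟩ := Finset.mem_map.1 hm
        rw [if_pos hm, if_pos (Finset.mem_map_of_mem e (Finset.mem_erase.2
          ⟨fun h => hi (congrArg e h), hy⟩))]
      · rw [if_neg hm]; exact Nat.zero_le _
  · push Not at h
    refine Or.inr fun B hB => Finset.eq_univ_of_forall fun x => ?_
    have := hB (e x)
    rw [squarefreeDegree_apply] at this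
    by_contra hx
    rw [if_neg (fun h => hx ((Finset.mem_map' e).1 h))] at this
    exact h x (Nat.le_zero.1 this)

lemma eq_squarefreeDegree_univ_iff (d : σ →₀ ℕ) :
    d = squarefreeDegree ((Finset.univ : Finset α).map e) ↔
      d ≤ squarefreeDegree ((Finset.univ : Finset α).map e) ∧
        ∀ B : Finset α, d ≤ squarefreeDegree (B.map e) → B = Finset.univ := by
  classical
  constructor
  · rintro rfl
    refine ⟨le_rfl, fun B hB => ?_⟩
    rw [squarefreeDegree_le_iff, Finset.map_subset_map] at hB
    exact Finset.univ_subset_iff.1 hB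
  · rintro ⟨h1, h2⟩
    refine le_antisymm h1 fun i => ?_
    rw [squarefreeDegree_apply]
    split_ifs with hi
    · obtain ⟨x, -, rfl⟩ := Finset.mem_map.1 hi
      by_contra h0
      have h3 := h2 (Finset.univ.erase x) fun i => by
        by_cases hix : i = e x
        · subst hix; omega
        · refine (h1 i).trans ?_
          rw [squarefreeDegree_apply, squarefreeDegree_apply]
          split_ifs with ha hb
          · exact le_rfl
          · obtain ⟨y, -, rfl⟩ := Finset.mem_map.1 ha
            exact absurd (Finset.mem_map_of_mem e (Finset.mem_erase.2
              ⟨fun h => hix (congrArg e h), Finset.mem_univ y⟩)) hb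
          · exact Nat.zero_le _
          · exact le_rfl
      exact (Finset.mem_erase.1 (h3.ge (Finset.mem_univ x))).1 rfl
    · exact Nat.zero_le _

end SquarefreeDegree

/-! ### Betti numbers through Koszul homology -/

section Betti

open MvPolynomial

variable {k : Type*} [Field k] {σ : Type*} {α : Type*} [Fintype α] [DecidableEq α]
variable {J K L : Type*} [Fintype J] [DecidableEq J] [Fintype K] [DecidableEq K]

/-- The squarefree degree parts of the image of a graded map. -/
noncomputable def imageFiltration (e : α ↪ σ) (deg : J → σ →₀ ℕ)
    (f : (J → MvPolynomial σ k) →ₗ[MvPolynomial σ k] (L → MvPolynomial σ k)) (B : Finset α) :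
    Submodule k (L → k) :=
  (degreeFiltration k deg (squarefreeDegree (B.map e))).map (dehomogenize f)

variable (e : α ↪ σ) {degJ : J → σ →₀ ℕ} {degK : K → σ →₀ ℕ} {degL : L → σ →₀ ℕ}
  {f : (J → MvPolynomial σ k) →ₗ[MvPolynomial σ k] (L → MvPolynomial σ k)}
  {g : (K → MvPolynomial σ k) →ₗ[MvPolynomial σ k] (J → MvPolynomial σ k)}

-- In the degree of the `j`-th generator, the `j`-th coordinate is a constant term, and the entries
-- of `g` have none.
omit [DecidableEq α] [Fintype J] [DecidableEq J] in
lemma imageFiltration_apply_eq_zero (hg : IsGradedMap degK degJ g)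
    (hmin : ∀ i j, constantCoeff (g (Pi.single i 1) j) = 0) {v : J → k}
    (hv : v ∈ imageFiltration e degK g Finset.univ) (j : J)
    (hj : degJ j = squarefreeDegree ((Finset.univ : Finset α).map e)) : v j = 0 := by
  rw [imageFiltration, map_dehomogenize hg] at hv
  obtain ⟨_, ⟨w, rfl⟩, rfl⟩ := hv
  rw [degreePart_of_le hj.le, hj, tsub_self, LinearMap.pi_apply_eq_sum_univ g w]
  change constantCoeff _ = 0
  rw [Finset.sum_apply, map_sum]
  refine Finset.sum_eq_zero fun i _ => ?_
  have : (fun j => if i = j then (1 : MvPolynomial σ k) else 0) = Pi.single i 1 := by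
    funext j
    simp [Pi.single_apply, eq_comm]
  rw [this, Pi.smul_apply, smul_eq_mul, map_mul, hmin, mul_zero]

variable {ρ : α → ℕ} (hρ : Function.Injective ρ) (hf : IsGradedMap degJ degL f)
  (hg : IsGradedMap degK degJ g) (hfg : LinearMap.range g = LinearMap.ker f)
  (hmin : ∀ i j, constantCoeff (g (Pi.single i 1) j) = 0)

omit [Fintype α] [DecidableEq α] [Fintype J] [DecidableEq J] in
lemma monotone_le_squarefreeDegree (j : J) :
    Monotone fun B : Finset α => degJ j ≤ squarefreeDegree (B.map e) :=
  fun _ _ h h' => h'.trans (squarefreeDegree_le_iff.2 (Finset.map_subset_map.2 h))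

include hf hg hfg hmin in
lemma imageFiltration_minimal (v : J → k) (hv : v ∈ imageFiltration e degK g Finset.univ) (j : J)
    (hj : ∀ B : Finset α, degJ j ≤ squarefreeDegree (B.map e) → B = Finset.univ) : v j = 0 := by
  by_contra hne
  have hv' := hv
  rw [imageFiltration, map_dehomogenize_eq_inf_ker hf hg hfg] at hv'
  exact hne (imageFiltration_apply_eq_zero e hg hmin hv j
    ((eq_squarefreeDegree_univ_iff e _).2 ⟨hv'.1 j hne, hj⟩))

include hρ hf hg hfg hmin

lemma koszulExactAt_imageFiltration_succ_iff (p : ℕ) :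
    KoszulExactAt ρ (imageFiltration e degJ f) (p + 1) ↔
      KoszulExactAt ρ (imageFiltration e degK g) p :=
  koszulExactAt_succ_iff hρ (P := fun j (B : Finset α) => degJ j ≤ squarefreeDegree (B.map e))
    (monotone_le_squarefreeDegree e) (fun j => le_squarefreeDegree_erase_or e (degJ j))
    (dehomogenize f) (fun _ => rfl) (fun _ => map_dehomogenize_eq_inf_ker hf hg hfg _)
    (imageFiltration_minimal e hf hg hfg hmin) p

lemma koszulExactAt_imageFiltration_zero_iff :
    KoszulExactAt ρ (imageFiltration e degJ f) 0 ↔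
      ∀ j, degJ j ≠ squarefreeDegree ((Finset.univ : Finset α).map e) := by
  refine (koszulExactAt_zero_iff hρ (P := fun j (B : Finset α) => degJ j ≤ squarefreeDegree (B.map e))
    (monotone_le_squarefreeDegree e) (fun j => le_squarefreeDegree_erase_or e (degJ j))
    (dehomogenize f) (fun _ => rfl) (fun _ => map_dehomogenize_eq_inf_ker hf hg hfg _)
    (imageFiltration_minimal e hf hg hfg hmin)).trans ?_
  refine forall_congr' fun j => ?_
  rw [Ne, eq_squarefreeDegree_univ_iff]
  push Not
  rfl

omit hρ hf hg hfg hmin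

variable {I : Ideal (MvPolynomial σ k)} (F : MinimalFreeResolution I)

/-- The augmentation of a resolution as a map between free modules. -/
noncomputable def MinimalFreeResolution.augmentation :
    (Fin (F.rank 0) → MvPolynomial σ k) →ₗ[MvPolynomial σ k] (Fin 1 → MvPolynomial σ k) :=
  LinearMap.pi fun _ => F.ε

lemma MinimalFreeResolution.augmentation_isGradedMap :
    IsGradedMap (F.deg 0) 0 F.augmentation := fun j _ a h => by
  rw [Pi.zero_apply, add_zero]
  exact F.ε_graded j a h

lemma MinimalFreeResolution.ker_augmentation : LinearMap.ker F.augmentation = LinearMap.ker F.ε := by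
  rw [augmentation, LinearMap.ker_pi, iInf_const]

-- Each shift lowers the Koszul degree and raises the index in the resolution by one. The separate
-- variable `q` avoids transport between the types `Fin (F.rank _)`.
include hρ in
lemma MinimalFreeResolution.koszulExactAt_d_iff (p : ℕ) : ∀ i q : ℕ, q = i + 1 + p →
    (KoszulExactAt ρ (imageFiltration e (F.deg (i + 1)) (F.d i)) p ↔
      ∀ j, F.deg q j ≠ squarefreeDegree ((Finset.univ : Finset α).map e)) := by
  induction p with
  | zero =>
    rintro i _ rfl
    exact koszulExactAt_imageFiltration_zero_iff e hρ (F.d_graded i) (F.d_graded (i + 1))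
      (F.exact_succ i) (F.minimal (i + 1))
  | succ p ih =>
    intro i q hq
    rw [koszulExactAt_imageFiltration_succ_iff e hρ (F.d_graded i) (F.d_graded (i + 1))
      (F.exact_succ i) (F.minimal (i + 1))]
    exact ih (i + 1) q (by omega)

include hρ in
/-- The multigraded Betti numbers in squarefree degrees are detected by Koszul homology. -/
lemma MinimalFreeResolution.koszulExactAt_augmentation_iff (p : ℕ) :
    KoszulExactAt ρ (imageFiltration e (F.deg 0) F.augmentation) p ↔
      ∀ j, F.deg p j ≠ squarefreeDegree ((Finset.univ : Finset α).map e) := by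
  have h0 := F.exact_zero.trans F.ker_augmentation.symm
  cases p with
  | zero =>
    exact koszulExactAt_imageFiltration_zero_iff e hρ F.augmentation_isGradedMap (F.d_graded 0) h0
      (F.minimal 0)
  | succ p =>
    rw [koszulExactAt_imageFiltration_succ_iff e hρ F.augmentation_isGradedMap (F.d_graded 0) h0
      (F.minimal 0)]
    exact F.koszulExactAt_d_iff e hρ p 0 (p + 1) (by omega)

omit [Fintype α] [DecidableEq α] in
lemma MinimalFreeResolution.mem_imageFiltration_augmentation {B : Finset α} {v : Fin 1 → k} :
    v ∈ imageFiltration e (F.deg 0) F.augmentation B ↔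
      ∃ p ∈ I, coeff (squarefreeDegree (B.map e)) p = v 0 := by
  rw [imageFiltration, map_dehomogenize F.augmentation_isGradedMap]
  constructor
  · rintro ⟨_, ⟨w, rfl⟩, rfl⟩
    exact ⟨F.ε w, F.range_ε.le ⟨w, rfl⟩, (degreePart_zero _ (F.augmentation w) 0).symm⟩
  · rintro ⟨p, hp, h⟩
    rw [← F.range_ε] at hp
    obtain ⟨w, rfl⟩ := hp
    refine ⟨F.augmentation w, ⟨w, rfl⟩, funext fun i => ?_⟩
    rw [Subsingleton.elim i 0, degreePart_zero, ← h]
    rfl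

lemma MinimalFreeResolution.multiplicity_ne_zero_iff (i : ℕ) (a : σ →₀ ℕ) :
    F.multiplicity i a ≠ 0 ↔ ∃ j, F.deg i j = a := by
  rw [multiplicity, Nat.card_ne_zero, nonempty_subtype, and_iff_left]
  exact inferInstance

end Betti

/-! ### Graded pieces of Stanley–Reisner ideals -/

section StanleyReisner

open MvPolynomial

variable {k : Type*} [Field k] {σ : Type*} {Δ : LowerSet (Finset σ)}

lemma mem_stanleyReisnerIdeal_iff {p : MvPolynomial σ k} :
    p ∈ stanleyReisnerIdeal k Δ ↔ ∀ m, coeff m p ≠ 0 → ∃ τ, τ ∉ Δ ∧ squarefreeDegree τ ≤ m := by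
  have : {p : MvPolynomial σ k | ∃ τ : Finset σ, τ ∉ Δ ∧ p = monomial (squarefreeDegree τ) 1}
      = (fun s => monomial s (1 : k)) '' {s | ∃ τ, τ ∉ Δ ∧ squarefreeDegree τ = s} := by
    ext p
    constructor
    · rintro ⟨τ, hτ, rfl⟩
      exact ⟨_, ⟨τ, hτ, rfl⟩, rfl⟩
    · rintro ⟨_, ⟨τ, hτ, rfl⟩, rfl⟩
      exact ⟨τ, hτ, rfl⟩
  rw [stanleyReisnerIdeal, this, mem_ideal_span_monomial_image]
  refine forall_congr' fun m => ?_
  rw [mem_support_iff]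
  refine imp_congr_right fun _ => ?_
  constructor
  · rintro ⟨_, ⟨τ, hτ, rfl⟩, h⟩
    exact ⟨τ, hτ, h⟩
  · rintro ⟨τ, hτ, h⟩
    exact ⟨_, ⟨τ, hτ, rfl⟩, h⟩

lemma isGradedSubmodule_stanleyReisnerIdeal :
    IsGradedSubmodule (J := Fin 1) 0
      (Submodule.comap (LinearMap.proj 0) (stanleyReisnerIdeal k Δ)) := by
  classical
  intro w hw b
  rw [Submodule.mem_comap, LinearMap.proj_apply, mem_stanleyReisnerIdeal_iff] at hw ⊢
  intro m hm
  rw [homogenize_zero, degreePart_zero, coeff_monomial] at hm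
  obtain ⟨rfl, h⟩ := ite_ne_right_iff.1 hm
  exact hw _ h

lemma coeff_squarefreeDegree_of_mem {p : MvPolynomial σ k} (hp : p ∈ stanleyReisnerIdeal k Δ)
    {s : Finset σ} (hs : s ∈ Δ) : coeff (squarefreeDegree s) p = 0 := by
  by_contra h
  obtain ⟨τ, hτ, hle⟩ := mem_stanleyReisnerIdeal_iff.1 hp _ h
  exact hτ (Δ.lower (squarefreeDegree_le_iff.1 hle) hs)

lemma monomial_squarefreeDegree_mem {s : Finset σ} (hs : s ∉ Δ) (a : k) :
    monomial (squarefreeDegree s) a ∈ stanleyReisnerIdeal k Δ := by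
  classical
  rw [mem_stanleyReisnerIdeal_iff]
  intro m hm
  rw [coeff_monomial] at hm
  exact ⟨s, hs, ((ite_ne_right_iff.1 hm).1).le⟩

end StanleyReisner

/-! ### Restriction to `U` and the theorem -/

/-- The inclusion of the vertices over `U`. -/
def vertexEmbedding {n m : ℕ} (U : Finset (Fin n)) : U × Fin m ↪ Fin n × Fin m :=
  Function.Embedding.prodMap (Function.Embedding.subtype _) (Function.Embedding.refl _)

lemma map_vertexEmbedding_univ {n m : ℕ} (U : Finset (Fin n)) :
    (Finset.univ : Finset (U × Fin m)).map (vertexEmbedding U) = U ×ˢ Finset.univ := by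
  ext ⟨i, j⟩
  simp [vertexEmbedding]

lemma map_vertexEmbedding_mem_iff {n m : ℕ} {C : Set (Fin n → Fin m)} {U : Finset (Fin n)}
    {B : Finset (U × Fin m)} : B.map (vertexEmbedding U) ∈ canonicalSuboplex C ↔
      ∃ g ∈ restrictClass C U, ∀ p ∈ B, g p.1 = p.2 := by
  constructor
  · rintro ⟨f, hf, h⟩
    exact ⟨_, ⟨f, hf, rfl⟩, fun p hp => h _ (Finset.mem_map_of_mem _ hp)⟩
  · rintro ⟨_, ⟨f, hf, rfl⟩, h⟩
    refine ⟨f, hf, fun q hq => ?_⟩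
    obtain ⟨p, hp, rfl⟩ := Finset.mem_map.1 hq
    exact h p hp

theorem mainTheorem10 (k : Type*) [Field k] (n : ℕ) (C : Set (Fin n → Fin 2))
    (U : Finset (Fin n)) (hU : U.Nonempty) :
    ClassShatters C U ↔
      bettiNumber (classIdeal k C) (U.card - 1)
        (squarefreeDegree (U ×ˢ (Finset.univ : Finset (Fin 2)))) ≠ 0 := by
  have hne : Nonempty (MinimalFreeResolution (classIdeal k C)) :=
    nonempty_minimalFreeResolution isGradedSubmodule_stanleyReisnerIdeal
  rw [bettiNumber, dif_pos hne, MinimalFreeResolution.multiplicity_ne_zero_iff]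
  -- The argument applies to any minimal resolution, so independence of the choice is not needed.
  generalize hne.some = F
  have : Nonempty U := hU.to_subtype
  have hr : Function.Injective fun u : U => (u : Fin n).val :=
    Fin.val_injective.comp Subtype.val_injective
  have h1 := F.koszulExactAt_augmentation_iff (vertexEmbedding U) (vertexRank_injective hr)
    (U.card - 1)
  have h2 := koszulExactAt_suboplex_iff (k := k) hr (D := restrictClass C U)
    (M := imageFiltration (vertexEmbedding U) (F.deg 0) F.augmentation)
    (fun B hB => by
      rw [eq_bot_iff]
      intro v hv
      obtain ⟨p, hp, h⟩ := (F.mem_imageFiltration_augmentation _).1 hv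
      rw [coeff_squarefreeDegree_of_mem hp (map_vertexEmbedding_mem_iff.2 hB)] at h
      refine funext fun i => ?_
      rw [Subsingleton.elim i 0, ← h]
      rfl)
    (fun B hB => by
      rw [eq_top_iff]
      rintro v -
      refine (F.mem_imageFiltration_augmentation _).2 ⟨_, monomial_squarefreeDegree_mem
        (fun h => hB (map_vertexEmbedding_mem_iff.1 h)) (v 0), ?_⟩
      classical
      rw [MvPolynomial.coeff_monomial, if_pos rfl])
  rw [Fintype.card_coe, h1, map_vertexEmbedding_univ] at h2
  rw [ClassShatters, ← not_iff_not, ← Ne, ← h2]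
  push Not
  rfl
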